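/- All graphs are finite and simple. Let $\Gamma$ be a graph with nonempty vertex set, let $\bar\Gamma$ be its complement, and let $\Gamma\bar\Gamma$ be the complementary prism, obtained from the disjoint union of $\Gamma$ and $\bar\Gamma$ by joining each vertex of $\Gamma$ to its copy in $\bar\Gamma$. A graph is self-complementary if it is isomorphic to its complement. For a (possibly null, i.e. without vertices) graph $\Lambda$, let $C_5(\Lambda)$ be the graph obtained from the pentagon $C_5$ by replacing one vertex by $\Lambda$, where the two neighbours of that vertex are joined to all vertices of $\Lambda$. Let the $A$-graph be the graph on five vertices consisting of a triangle, two of whose vertices each have one further neighbour, these two further vertices being distinct and of degree one; let $A(\Lambda)$ be the graph obtained from the $A$-graph by replacing its vertex of degree two by $\Lambda$, where the two neighbours of that vertex are joined to all vertices of $\Lambda$. The null graph counts as self-complementary. Then the number $$\frac{|\mathrm{Aut}(\Gamma\bar\Gamma)|}{|\mathrm{Aut}(\Gamma)|}$$ equals: (i) $12$ if $\Gamma$ is (isomorphic to) the pentagon; (ii) $4$ if $\Gamma$ is isomorphic to either $A(\Lambda)$ or $C_5(\Lambda)$, where $\Lambda$ is a (possibly null) self-complementary graph, and where $|V(\Lambda)|\neq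 1$ in the $C_5(\Lambda)$ case; (iii) $2$ if $\Gamma$ is a self-complementary graph that is not included in (i) and (ii), or $\Gamma$ is isomorphic to either $A(\Lambda)$ or $C_5(\Lambda)$, where $\Lambda$ is a graph that is not self-complementary; (iv) $1$ otherwise. -/

import Mathlib

namespace ComplPrism

universe u

/-- A graph is self-complementary if it is isomorphic to its complement. -/
def IsSelfCompl {V : Type u} (G : SimpleGraph V) : Prop :=
  Nonempty (G ≃g Gᶜ)

/-- The complementary prism of `G`: the disjoint union of `G` (left summand) and its complement
(right summand), in which every vertex is joined to its copy. -/
def prism {V : Type u} (G : SimpleGraph V) : SimpleGraph (V ⊕ V) where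
  Adj
    | Sum.inl v, Sum.inl w => G.Adj v w
    | Sum.inr v, Sum.inr w => Gᶜ.Adj v w
    | Sum.inl v, Sum.inr w => v = w
    | Sum.inr v, Sum.inl w => v = w
  symm := ⟨by
    rintro (v | v) (w | w) h
    · exact SimpleGraph.Adj.symm h
    · exact Eq.symm h
    · exact Eq.symm h
    · exact SimpleGraph.Adj.symm h⟩
  loopless := ⟨by
    rintro (v | v) h
    · exact G.irrefl h
    · exact Gᶜ.irrefl h⟩

/-- The graph obtained from `G` by replacing the vertex `a` by the (possibly null) graph `L`:
every neighbour of `a` in `G` is joined to all vertices of `L`. -/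
def substVertex {B : Type} {W : Type u} (G : SimpleGraph B) (a : B) (L : SimpleGraph W) :
    SimpleGraph ({x : B // x ≠ a} ⊕ W) where
  Adj
    | Sum.inl x, Sum.inl y => G.Adj x y
    | Sum.inr x, Sum.inr y => L.Adj x y
    | Sum.inl x, Sum.inr _ => G.Adj x a
    | Sum.inr _, Sum.inl y => G.Adj y a
  symm := ⟨by
    rintro (x | x) (y | y) h
    · exact SimpleGraph.Adj.symm h
    · exact h
    · exact h
    · exact SimpleGraph.Adj.symm h⟩
  loopless := ⟨by
    rintro (x | x) h
    · exact G.irrefl h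
    · exact L.irrefl h⟩

/-- The pentagon. -/
def pentagon : SimpleGraph (Fin 5) := SimpleGraph.cycleGraph 5

/-- The `A`-graph: a triangle `0, 1, 2` whose vertices `1` and `2` each have one further
neighbour (`3` and `4` respectively), of degree one. Its vertex of degree two is `0`. -/
def aGraph : SimpleGraph (Fin 5) :=
  SimpleGraph.fromEdgeSet {s(0, 1), s(0, 2), s(1, 2), s(1, 3), s(2, 4)}

/-- `C₅(L)`: the pentagon with one vertex replaced by `L`. -/
def c5 {W : Type u} (L : SimpleGraph W) : SimpleGraph ({x : Fin 5 // x ≠ 0} ⊕ W) :=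
  substVertex pentagon 0 L

/-- `A(L)`: the `A`-graph with its vertex of degree two replaced by `L`. -/
def aOf {W : Type u} (L : SimpleGraph W) : SimpleGraph ({x : Fin 5 // x ≠ 0} ⊕ W) :=
  substVertex aGraph 0 L

/-- `G` is the pentagon, up to isomorphism. -/
def IsPentagon {V : Type u} (G : SimpleGraph V) : Prop :=
  Nonempty (G ≃g pentagon)

/-- `G` is isomorphic to `A(L)`, or to `C₅(L)` with `L` not a one-vertex graph, for some finite
(possibly null) self-complementary graph `L`. -/
def IsExtensionOfSelfCompl {V : Type u} (G : SimpleGraph V) : Prop :=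
  ∃ (W : Type u) (_ : Finite W) (L : SimpleGraph W), IsSelfCompl L ∧
    (Nonempty (G ≃g aOf L) ∨ (Nonempty (G ≃g c5 L) ∧ Nat.card W ≠ 1))

/-- `G` is isomorphic to `A(L)` or to `C₅(L)`, for some finite graph `L` that is not
self-complementary. -/
def IsExtensionOfNonSelfCompl {V : Type u} (G : SimpleGraph V) : Prop :=
  ∃ (W : Type u) (_ : Finite W) (L : SimpleGraph W), ¬ IsSelfCompl L ∧
    (Nonempty (G ≃g aOf L) ∨ Nonempty (G ≃g c5 L))

/-- The ratio of the numbers of automorphisms of the complementary prism of `G` and of `G`. -/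
noncomputable def autRatio {V : Type u} (G : SimpleGraph V) : ℚ :=
  (Nat.card (prism G ≃g prism G) : ℚ) / (Nat.card (G ≃g G) : ℚ)

end ComplPrism

/-! The automorphisms of the prism act on subsets of `V ⊕ V`. The stabilizer of the left summand is
Aut `G`, because the matching edges force the action on the copies. By orbit-stabilizer the ratio is
the size of the orbit `sides G` (`card_prism_aut`).

A side `X` is joined to its complement by a perfect matching only. Call a vertex together with its
copy a column. Up to complementing `X`, either `X` is the left summand, or exactly two columns lie
inside `X`, exactly two lie outside, and all others have only their left vertex in `X`; the matching
condition then makes the four exceptional vertices a `Quad` (`IsSplit.eq_or_quad`). Conversely every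
`Quad` yields an automorphism producing such a side (`Quad.iso_image`). Having a `Quad` means being
`A(Λ)` or `C₅(Λ)`, according to whether `p₁ p₂` is an edge, with `Λ` induced on the remaining
vertices (`Quad.substVertex`, `Quad.nonempty_iso`).

The complement of a side is a side exactly when `G` is self-complementary (`compl_mem_sides`).
Except for the pentagon, all quads give one side up to complement (`Quad.side_eq`), so there are 1
or 2 sides without a quad and 2 or 4 with one. The pentagon has five quad sides, giving 2 · (1 + 5)
= 12. -/

namespace ComplPrism

universe u

variable {V : Type u}

/-! ### Quads and their uniqueness -/

section Quad

/-- Two adjacent-or-not vertices `p₁, p₂` and two vertices `s₁, s₂` such that `pᵢ` is adjacent to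
`sⱼ` exactly when `i = j`, exactly one of the pairs `p₁ p₂`, `s₁ s₂` is an edge, and every other
vertex is adjacent to both `p₁, p₂` and to none of `s₁, s₂`. -/
structure Quad (G : SimpleGraph V) (p₁ p₂ s₁ s₂ : V) : Prop where
  adj₁ : G.Adj p₁ s₁
  adj₂ : G.Adj p₂ s₂
  nadj₁ : ¬ G.Adj p₁ s₂
  nadj₂ : ¬ G.Adj p₂ s₁
  hp : p₁ ≠ p₂
  hs : s₁ ≠ s₂
  hps₁ : p₁ ≠ s₂
  hps₂ : p₂ ≠ s₁
  iff : G.Adj p₁ p₂ ↔ ¬ G.Adj s₁ s₂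
  rest : ∀ q, q ≠ p₁ → q ≠ p₂ → q ≠ s₁ → q ≠ s₂ →
    G.Adj q p₁ ∧ G.Adj q p₂ ∧ ¬ G.Adj q s₁ ∧ ¬ G.Adj q s₂

/-- The side of the prism obtained from the left summand by exchanging `s₁, s₂` for the copies
of `p₁, p₂`. -/
def quadSide (p₁ p₂ s₁ s₂ : V) : Set (V ⊕ V) :=
  {x | Sum.elim (fun v => v ≠ s₁ ∧ v ≠ s₂) (fun v => v = p₁ ∨ v = p₂) x}

variable {G : SimpleGraph V} {p₁ p₂ s₁ s₂ : V}

theorem Quad.swap (h : Quad G p₁ p₂ s₁ s₂) : Quad G p₂ p₁ s₂ s₁ := by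
  obtain ⟨h1, h2, h3, h4, h5, h6, h7, h8, h9, h10⟩ := h
  refine ⟨h2, h1, h4, h3, h5.symm, h6.symm, h8, h7, ?_, fun q a b c d => ?_⟩
  · rw [G.adj_comm p₂, G.adj_comm s₂]; exact h9
  · obtain ⟨a, b, c, d⟩ := h10 q b a d c
    exact ⟨b, a, d, c⟩

/-- Complementation exchanges the roles of the two pairs; the order of the `p`'s is reversed because
`s₁` is a non-neighbour of `p₂`, not of `p₁`. -/
theorem Quad.compl (h : Quad G p₁ p₂ s₁ s₂) : Quad Gᶜ s₁ s₂ p₂ p₁ := by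
  have h1 := h.adj₁
  have h2 := h.adj₂
  obtain ⟨-, -, h3, h4, h5, h6, h7, h8, h9, h10⟩ := h
  constructor <;> simp only [SimpleGraph.compl_adj, G.adj_comm, ne_eq] <;>
    grind [SimpleGraph.adj_comm, G.ne_of_adj h1, G.ne_of_adj h2]

theorem Quad.map {W : Type*} {H : SimpleGraph W} (e : G ≃g H) (h : Quad G p₁ p₂ s₁ s₂) :
    Quad H (e p₁) (e p₂) (e s₁) (e s₂) := by
  obtain ⟨h1, h2, h3, h4, h5, h6, h7, h8, h9, h10⟩ := h
  constructor
  case rest =>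
    intro q a b c d
    obtain ⟨q, rfl⟩ := e.surjective q
    simp only [e.map_adj_iff]
    exact h10 q (by grind) (by grind) (by grind) (by grind)
  all_goals simpa [e.map_adj_iff]

/-- Outside `s₁` itself, the only possible neighbours of `s₁` are `p₁` and `s₂`. -/
theorem Quad.eq_of_adj (h : Quad G p₁ p₂ s₁ s₂) {v : V} (hv : G.Adj v s₁) : v = p₁ ∨ v = s₂ := by
  by_contra! hc
  have h1 : v ≠ p₂ := fun e => h.nadj₂ (e ▸ hv)
  exact (h.rest v hc.1 h1 hv.ne hc.2).2.2.1 hv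

theorem exists_ne_pair_of_six_le_card [Finite V] (h6 : 6 ≤ Nat.card V) (a b c d : V) :
    ∃ x y, x ≠ y ∧ x ≠ a ∧ x ≠ b ∧ x ≠ c ∧ x ≠ d ∧ y ≠ a ∧ y ≠ b ∧ y ≠ c ∧ y ≠ d := by
  classical
  have := Fintype.ofFinite V
  have hc : 1 < (({a, b, c, d} : Finset V)ᶜ).card := by
    rw [Finset.card_compl, ← Nat.card_eq_fintype_card]
    have := Finset.card_le_four (a := a) (b := b) (c := c) (d := d)
    omega
  obtain ⟨x, hx, y, hy, hxy⟩ := Finset.one_lt_card.1 hc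
  exact ⟨x, y, hxy, by grind [Finset.mem_compl]⟩

theorem exists_ne_of_five_le_card [Finite V] (h5 : 5 ≤ Nat.card V) (a b c d : V) :
    ∃ x, x ≠ a ∧ x ≠ b ∧ x ≠ c ∧ x ≠ d := by
  classical
  have := Fintype.ofFinite V
  have hc : 0 < (({a, b, c, d} : Finset V)ᶜ).card := by
    rw [Finset.card_compl, ← Nat.card_eq_fintype_card]
    have := Finset.card_le_four (a := a) (b := b) (c := c) (d := d)
    omega
  obtain ⟨x, hx⟩ := Finset.card_pos.1 hc
  exact ⟨x, by grind [Finset.mem_compl]⟩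

variable {p₁' p₂' s₁' s₂' : V}

/-- A degree count: `s₁` has at most two neighbours, and only one if `p₁ p₂` is an edge, whereas
`p₁'` is adjacent to `s₁'` and to every vertex outside its quad. -/
theorem Quad.s_ne_p [Finite V] (hc : 6 ≤ Nat.card V ∨ 5 ≤ Nat.card V ∧ G.Adj p₁ p₂)
    (h : Quad G p₁ p₂ s₁ s₂) (h' : Quad G p₁' p₂' s₁' s₂') : s₁ ≠ p₁' := by
  rintro rfl
  have a0 := h.eq_of_adj h'.adj₁.symm
  rcases hc with hc | ⟨hc, hA⟩
  · obtain ⟨x, y, hxy, x1, x2, x3, x4, y1, y2, y3, y4⟩ := exists_ne_pair_of_six_le_card hc s₁ p₂' s₁' s₂'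
    have a1 := h.eq_of_adj (h'.rest x x1 x2 x3 x4).1
    have a2 := h.eq_of_adj (h'.rest y y1 y2 y3 y4).1
    grind
  · obtain ⟨x, x1, x2, x3, x4⟩ := exists_ne_of_five_le_card hc s₁ p₂' s₁' s₂'
    have a1 := h.eq_of_adj (h'.rest x x1 x2 x3 x4).1
    have b0 := h'.adj₁
    have b1 := (h'.rest x x1 x2 x3 x4).1
    have b2 := h.iff.1 hA
    grind [SimpleGraph.adj_comm]

theorem Quad.s_mem [Finite V] (hc : 6 ≤ Nat.card V ∨ 5 ≤ Nat.card V ∧ G.Adj p₁ p₂)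
    (h : Quad G p₁ p₂ s₁ s₂) (h' : Quad G p₁' p₂' s₁' s₂') : s₁ = s₁' ∨ s₁ = s₂' := by
  have hc' : 6 ≤ Nat.card V ∨ 5 ≤ Nat.card V ∧ G.Adj p₂ p₁ := by rwa [G.adj_comm p₂]
  have n1 := h.s_ne_p hc h'
  have n2 := h.s_ne_p hc h'.swap
  have n3 := h.swap.s_ne_p hc' h'
  have n4 := h.swap.s_ne_p hc' h'.swap
  -- Otherwise `s₁` is adjacent to both `p₁'` and `p₂'`, so these are `p₁` and `s₂` in some order,
  -- but `s₂` is neither of them.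
  by_contra! hs
  obtain ⟨a, b, -, -⟩ := h'.rest s₁ n1 n2 hs.1 hs.2
  have := h.eq_of_adj a.symm
  have := h.eq_of_adj b.symm
  grind [h'.hp]

theorem Quad.s_eq [Finite V] (hc : 6 ≤ Nat.card V ∨ 5 ≤ Nat.card V ∧ G.Adj p₁ p₂)
    (h : Quad G p₁ p₂ s₁ s₂) (h' : Quad G p₁' p₂' s₁' s₂') :
    s₁ = s₁' ∧ s₂ = s₂' ∨ s₁ = s₂' ∧ s₂ = s₁' := by
  have hc' : 6 ≤ Nat.card V ∨ 5 ≤ Nat.card V ∧ G.Adj p₂ p₁ := by rwa [G.adj_comm p₂]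
  have n1 := h.s_mem hc h'
  have n2 := h.swap.s_mem hc' h'
  grind [h.hs]

theorem Quad.p_eq [Finite V] (hc : 6 ≤ Nat.card V ∨ 5 ≤ Nat.card V ∧ G.Adj p₁ p₂)
    (h : Quad G p₁ p₂ s₁ s₂) (h' : Quad G p₁' p₂' s₁' s₂') :
    p₁ = p₁' ∧ p₂ = p₂' ∨ p₁ = p₂' ∧ p₂ = p₁' := by
  have hc' : 6 ≤ Nat.card V ∨ 5 ≤ Nat.card V ∧ Gᶜ.Adj s₁ s₂ := by
    refine hc.imp_right fun k => ⟨k.1, ?_⟩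
    rw [SimpleGraph.compl_adj]
    exact ⟨h.hs, h.iff.1 k.2⟩
  have := h.compl.s_eq hc' h'.compl
  grind

/-- Here `G` is a path on four vertices, and its inner and outer pairs may exchange roles; doing so
complements the side. -/
theorem Quad.side_eq_of_card_four (h : Quad G p₁ p₂ s₁ s₂) (h' : Quad G p₁' p₂' s₁' s₂')
    (hV : ∀ v : V, v = p₁ ∨ v = p₂ ∨ v = s₁ ∨ v = s₂) :
    quadSide p₁' p₂' s₁' s₂' = quadSide p₁ p₂ s₁ s₂ ∨
      quadSide p₁' p₂' s₁' s₂' = (quadSide p₁ p₂ s₁ s₂)ᶜ := by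
  have d1 := h.adj₁.ne
  have d2 := h.adj₂.ne
  have d1' := h'.adj₁.ne
  have d2' := h'.adj₂.ne
  have key : ((p₁' = p₁ ∧ p₂' = p₂ ∨ p₁' = p₂ ∧ p₂' = p₁) ∧
      (s₁' = s₁ ∧ s₂' = s₂ ∨ s₁' = s₂ ∧ s₂' = s₁)) ∨
      ((p₁' = s₁ ∧ p₂' = s₂ ∨ p₁' = s₂ ∧ p₂' = s₁) ∧
      (s₁' = p₁ ∧ s₂' = p₂ ∨ s₁' = p₂ ∧ s₂' = p₁)) := by
    obtain ⟨h1, h2, h3, h4, h5, h6, h7, h8, h9, h10⟩ := h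
    obtain ⟨h1', h2', h3', h4', h5', h6', h7', h8', h9', h10'⟩ := h'
    clear h10 h10'
    rcases hV p₁' with rfl | rfl | rfl | rfl <;> rcases hV p₂' with rfl | rfl | rfl | rfl <;>
      rcases hV s₁' with rfl | rfl | rfl | rfl <;> rcases hV s₂' with rfl | rfl | rfl | rfl <;>
      first
      | contradiction
      | (exfalso; grind [SimpleGraph.adj_comm])
      | (clear hV; grind)
  have hd := h.hp
  have hd2 := h.hs
  have hd3 := h.hps₁
  have hd4 := h.hps₂
  rcases key with ⟨k1, k2⟩ | ⟨k1, k2⟩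
  · left
    ext (v | v) <;> simp only [quadSide, Set.mem_ofPred_eq, Sum.elim_inl, Sum.elim_inr] <;> grind
  · right
    ext (v | v) <;> simp only [quadSide, Set.mem_compl_iff, Set.mem_ofPred_eq, Sum.elim_inl,
      Sum.elim_inr] <;> have := hV v <;> grind

/-- The hypothesis `hc` excludes precisely the pentagon among graphs with a quad. With at least five
vertices the unordered pairs are unique, and the side depends only on them. -/
theorem Quad.side_eq [Finite V] (hc : Nat.card V ≠ 5 ∨ G.Adj p₁ p₂)
    (h : Quad G p₁ p₂ s₁ s₂) (h' : Quad G p₁' p₂' s₁' s₂') :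
    quadSide p₁' p₂' s₁' s₂' = quadSide p₁ p₂ s₁ s₂ ∨
      quadSide p₁' p₂' s₁' s₂' = (quadSide p₁ p₂ s₁ s₂)ᶜ := by
  by_cases hV : ∀ v : V, v = p₁ ∨ v = p₂ ∨ v = s₁ ∨ v = s₂
  · exact h.side_eq_of_card_four h' hV
  have h5 : 5 ≤ Nat.card V := by
    classical
    push Not at hV
    obtain ⟨q, q1, q2, q3, q4⟩ := hV
    have := Fintype.ofFinite V
    have hcard : ({q, p₁, p₂, s₁, s₂} : Finset V).card = 5 := by
      have d1 := h.adj₁.ne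
      have d2 := h.adj₂.ne
      have d3 := h.hp
      have d4 := h.hs
      have d5 := h.hps₁
      have d6 := h.hps₂
      repeat rw [Finset.card_insert_of_notMem (by simp [*])]
      simp
    rw [← hcard, Nat.card_eq_fintype_card]
    exact Finset.card_le_univ _
  have hc' : 6 ≤ Nat.card V ∨ 5 ≤ Nat.card V ∧ G.Adj p₁ p₂ := by
    rcases hc with hc | hc
    · left; omega
    · exact Or.inr ⟨h5, hc⟩
  left
  have a := h.s_eq hc' h'
  have b := h.p_eq hc' h'
  ext (v | v) <;> simp only [quadSide, Set.mem_ofPred_eq, Sum.elim_inl, Sum.elim_inr] <;> grind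

end Quad

end ComplPrism

namespace ComplPrism

universe u

variable {V : Type u}

/-! ### Sides of the prism as splits -/

section Adj

variable (G : SimpleGraph V) (v w : V)

@[simp] theorem prism_inl_inl : (prism G).Adj (.inl v) (.inl w) ↔ G.Adj v w := Iff.rfl
@[simp] theorem prism_inr_inr : (prism G).Adj (.inr v) (.inr w) ↔ v ≠ w ∧ ¬ G.Adj v w :=
  SimpleGraph.compl_adj ..
@[simp] theorem prism_inl_inr : (prism G).Adj (.inl v) (.inr w) ↔ v = w := Iff.rfl
@[simp] theorem prism_inr_inl : (prism G).Adj (.inr v) (.inl w) ↔ v = w := Iff.rfl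

end Adj

section Split

/-- `X` is one side of a presentation of the prism of `G` as a complementary prism, with matching
`m` between the two sides. -/
structure IsSplit (G : SimpleGraph V) (X : Set (V ⊕ V)) (m : V ⊕ V → V ⊕ V) : Prop where
  mem_iff : ∀ x, m x ∈ X ↔ x ∉ X
  cross : ∀ x y, (x ∈ X ↔ y ∉ X) → ((prism G).Adj x y ↔ y = m x)
  same : ∀ x y, (x ∈ X ↔ y ∈ X) → x ≠ y → ((prism G).Adj x y ↔ ¬ (prism G).Adj (m x) (m y))

variable {G : SimpleGraph V} {X : Set (V ⊕ V)} {m : V ⊕ V → V ⊕ V}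

theorem IsSplit.compl (h : IsSplit G X m) : IsSplit G Xᶜ m := by
  obtain ⟨h1, h2, h3⟩ := h
  refine ⟨fun x => ?_, fun x y hxy => h2 x y ?_, fun x y hxy => h3 x y ?_⟩ <;>
    simp only [Set.mem_compl_iff] at * <;> grind

theorem isSplit_image (σ : prism G ≃g prism G) :
    IsSplit G (σ '' Set.range Sum.inl) (fun x => σ (σ.symm x).swap) := by
  have mem : ∀ x, σ x ∈ σ '' Set.range Sum.inl ↔ x ∈ Set.range Sum.inl := fun x =>
    σ.injective.mem_set_image
  have adj : ∀ x y, (prism G).Adj (σ x) (σ y) ↔ (prism G).Adj x y := fun x y => σ.map_adj_iff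
  constructor
  · intro x
    obtain ⟨x, rfl⟩ := σ.surjective x
    rw [mem, mem]
    rcases x with x | x <;> simp
  · intro x y
    obtain ⟨x, rfl⟩ := σ.surjective x
    obtain ⟨y, rfl⟩ := σ.surjective y
    rw [mem, mem]
    rcases x with x | x <;> rcases y with y | y <;> simp [adj, eq_comm]
  · intro x y
    obtain ⟨x, rfl⟩ := σ.surjective x
    obtain ⟨y, rfl⟩ := σ.surjective y
    rw [mem, mem]
    rcases x with x | x <;> rcases y with y | y <;> simp +contextual [adj]

/-- Both columns would be matched internally, so neither `v w` nor the copy of this pair could be an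
edge across the split; yet one of the two is an edge of the prism. -/
theorem IsSplit.not_mixed (h : IsSplit G X m) {v w : V} (hv : Sum.inl v ∈ X) (hv' : Sum.inr v ∉ X)
    (hw : Sum.inl w ∉ X) (hw' : Sum.inr w ∈ X) : False := by
  have h1 : Sum.inr v = m (Sum.inl v) :=
    (h.cross (.inl v) (.inr v) (by simp [hv, hv'])).1 (by simp)
  have h2 : Sum.inl v = m (Sum.inr v) :=
    (h.cross (.inr v) (.inl v) (by simp [hv, hv'])).1 (by simp)
  have h3 := h.cross (.inl v) (.inl w) (by simp [hv, hw])
  have h4 := h.cross (.inr v) (.inr w) (by simp [hv', hw'])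
  rw [← h1] at h3
  rw [← h2] at h4
  simp only [prism_inl_inl, prism_inr_inr, reduceCtorEq, iff_false] at h3 h4
  grind

theorem IsSplit.eq_or_quad (h : IsSplit G X m) (hR : ∀ v, Sum.inr v ∈ X → Sum.inl v ∈ X) :
    X = Set.range Sum.inl ∨ ∃ p₁ p₂ s₁ s₂, Quad G p₁ p₂ s₁ s₂ ∧ X = quadSide p₁ p₂ s₁ s₂ := by
  have mem := h.mem_iff
  have adjm : ∀ x, (prism G).Adj x (m x) := fun x => (h.cross x (m x) (by grind)).2 rfl
  have cross := h.cross
  have mm : ∀ x, m (m x) = x := fun x =>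
    ((cross (m x) x (by grind)).1 (adjm x).symm).symm
  -- A column inside `X` cannot be matched internally, so its two partners lie in the same summands
  -- as the vertices themselves. Their columns lie wholly outside `X`.
  have key : ∀ p, Sum.inr p ∈ X → ∃ s₁ s₂, m (.inl p) = .inl s₁ ∧ m (.inr p) = .inr s₂ ∧
      G.Adj p s₁ ∧ ¬ G.Adj p s₂ ∧ p ≠ s₂ ∧ s₁ ≠ s₂ ∧
      Sum.inl s₁ ∉ X ∧ Sum.inr s₁ ∉ X ∧ Sum.inl s₂ ∉ X ∧ Sum.inr s₂ ∉ X := by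
    intro p hp
    have hp' := hR p hp
    have a := adjm (.inl p)
    have b := adjm (.inr p)
    have a' := mem (.inl p)
    have b' := mem (.inr p)
    have b'' := mm (.inr p)
    rcases e1 : m (.inl p) with s₁ | s₁ <;> rcases e2 : m (.inr p) with s₂ | s₂ <;>
      rw [e1] at a a' <;> rw [e2] at b b' b'' <;> simp at a b <;> try grind
    have : Sum.inl s₂ ∉ X := by
      intro hs
      have := (cross (.inr s₂) (.inl s₂) (by grind)).1 (by simp)
      grind
    exact ⟨s₁, s₂, by grind⟩
  have key' : ∀ s, Sum.inl s ∉ X → ∃ p, m (.inr s) = .inr p ∧ Sum.inr p ∈ X ∧ ¬ G.Adj s p := by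
    intro s hs
    have hs' : Sum.inr s ∉ X := fun k => hs (hR s k)
    have b := adjm (.inr s)
    have b' := mem (.inr s)
    rcases e2 : m (.inr s) with p | p <;> rw [e2] at b b' <;> simp at b
    · grind
    · exact ⟨p, by grind⟩
  by_cases hP : ∃ p, Sum.inr p ∈ X
  swap
  · left
    push Not at hP
    ext (v | v)
    · simp only [Set.mem_range, Sum.inl.injEq, exists_eq, iff_true]
      by_contra hv
      obtain ⟨p, -, hp, -⟩ := key' v hv
      exact hP p hp
    · simp [hP v]
  right
  obtain ⟨p₁, hp₁⟩ := hP
  obtain ⟨s₁, s₂, ms₁, ms₂, adj₁, nadj₁, ne, ne', k1, k2, k3, k4⟩ := key p₁ hp₁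
  obtain ⟨p₂, mp₂, hp₂, nadj₂⟩ := key' s₁ k1
  have hp₁' := hR _ hp₁
  have hp₂' := hR _ hp₂
  -- Between an inside and an outside column there is always an edge, in the left or the right
  -- summand. It crosses the split, so it is one of the two matching edges at `p₁`.
  have hS : ∀ s, Sum.inl s ∉ X → s = s₁ ∨ s = s₂ := by
    intro s hs
    have hs' : Sum.inr s ∉ X := fun k => hs (hR s k)
    by_cases ha : G.Adj p₁ s
    · have := (cross (.inl p₁) (.inl s) (by grind)).1 (by simpa)
      grind
    · have := (cross (.inr p₁) (.inr s) (by grind)).1 (by simp only [prism_inr_inr]; grind)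
      grind
  have hPP : ∀ p, Sum.inr p ∈ X → p = p₁ ∨ p = p₂ := by
    intro p hp
    have hp' := hR p hp
    by_cases ha : G.Adj s₁ p
    · have := (cross (.inl s₁) (.inl p) (by grind)).1 (by simpa)
      grind
    · have := (cross (.inr s₁) (.inr p) (by grind)).1 (by simp only [prism_inr_inr]; grind)
      grind
  have hpp : p₁ ≠ p₂ := by
    rintro rfl
    exact nadj₂ adj₁.symm
  obtain ⟨t, t', mt, -, adjt, -, -, -, t1, -, -, -⟩ := key p₂ hp₂
  obtain rfl : t = s₂ := by
    have := hS t t1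
    have := adjt.symm
    grind
  refine ⟨p₁, p₂, s₁, t, ⟨adj₁, adjt, nadj₁, fun k => nadj₂ k.symm, hpp, ne', ne, by grind, ?_,
    ?_⟩, ?_⟩
  · have := h.same (.inl p₁) (.inl p₂) (by simp [hp₁', hp₂']) (by simpa)
    simpa [ms₁, mt] using this
  · intro q q1 q2 q3 q4
    have hq : Sum.inl q ∈ X := by
      by_contra hq
      have := hS q hq
      grind
    have hq' : Sum.inr q ∉ X := by
      intro hq
      have := hPP q hq
      grind
    -- The column of `q` is matched internally, so no other edge at it crosses the split; this
    -- determines all adjacencies between `q` and the quad.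
    have e1 : Sum.inr q = m (.inl q) := (cross (.inl q) (.inr q) (by grind)).1 (by simp)
    have e2 : Sum.inl q = m (.inr q) := (cross (.inr q) (.inl q) (by grind)).1 (by simp)
    have c1 := cross (.inr q) (.inr p₁) (by grind)
    have c2 := cross (.inr q) (.inr p₂) (by grind)
    have c3 := cross (.inl q) (.inl s₁) (by grind)
    have c4 := cross (.inl q) (.inl t) (by grind)
    rw [← e1] at c3 c4
    rw [← e2] at c1 c2
    simp at c1 c2 c3 c4
    exact ⟨c1 q1, c2 q2, c3, c4⟩
  · ext (v | v) <;> simp only [quadSide, Set.mem_ofPred_eq, Sum.elim_inl, Sum.elim_inr]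
    · have := hS v
      grind
    · have := hPP v
      grind

theorem IsSplit.cases (h : IsSplit G X m) :
    (X = Set.range Sum.inl ∨ ∃ p₁ p₂ s₁ s₂, Quad G p₁ p₂ s₁ s₂ ∧ X = quadSide p₁ p₂ s₁ s₂) ∨
    (Xᶜ = Set.range Sum.inl ∨ ∃ p₁ p₂ s₁ s₂, Quad G p₁ p₂ s₁ s₂ ∧ Xᶜ = quadSide p₁ p₂ s₁ s₂) := by
  by_cases hR : ∀ v, Sum.inr v ∈ X → Sum.inl v ∈ X
  · exact Or.inl (h.eq_or_quad hR)
  · right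
    push Not at hR
    obtain ⟨w, hw, hw'⟩ := hR
    refine h.compl.eq_or_quad fun v hv hv' => ?_
    exact h.not_mixed hv' hv hw' hw

end Split

/-! ### The automorphism attached to a quad -/

section Involution

variable {G : SimpleGraph V} {p₁ p₂ s₁ s₂ : V}

open Classical in
/-- Exchange `sᵢ` with the copy of `pᵢ`, and the copies of `s₁` and `s₂` with each other. -/
noncomputable def quadSwap (p₁ p₂ s₁ s₂ : V) : V ⊕ V → V ⊕ V
  | .inl v => if v = s₁ then .inr p₁ else if v = s₂ then .inr p₂ else .inl v
  | .inr v => if v = p₁ then .inl s₁ else if v = p₂ then .inl s₂ else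
      if v = s₁ then .inr s₂ else if v = s₂ then .inr s₁ else .inr v

theorem Quad.quadSwap_invol (h : Quad G p₁ p₂ s₁ s₂) :
    Function.Involutive (quadSwap p₁ p₂ s₁ s₂) := by
  have d1 := h.adj₁.ne
  have d2 := h.adj₂.ne
  have d3 := h.hp
  have d4 := h.hs
  have d5 := h.hps₁
  have d6 := h.hps₂
  rintro (v | v) <;> grind [quadSwap]

/-- Neither `sᵢ` nor the copy of `pᵢ` has a neighbour in the columns outside the quad, and both are
adjacent to `pᵢ`. Their remaining matching and complement edges correspond once the copies of `s₁,
s₂` are exchanged, and the field `iff` matches `s₁ s₂` with the copy of `p₁ p₂`. -/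
theorem Quad.quadSwap_adj (h : Quad G p₁ p₂ s₁ s₂) {x y : V ⊕ V} (hxy : (prism G).Adj x y) :
    (prism G).Adj (quadSwap p₁ p₂ s₁ s₂ x) (quadSwap p₁ p₂ s₁ s₂ y) := by
  have d1 := h.adj₁.ne
  have d2 := h.adj₂.ne
  have hne := hxy.ne
  obtain ⟨h1, h2, h3, h4, h5, h6, h7, h8, h9, h10⟩ := h
  rcases x with x | x <;> rcases y with y | y <;>
    simp only [prism_inl_inl, prism_inr_inr, prism_inl_inr, prism_inr_inl] at hxy <;>
    simp only [quadSwap] <;> split_ifs <;>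
    simp only [prism_inl_inl, prism_inr_inr, prism_inl_inr, prism_inr_inl] <;>
    grind [SimpleGraph.adj_comm]

/-- The automorphism of the prism given by `quadSwap`. -/
noncomputable def Quad.iso (h : Quad G p₁ p₂ s₁ s₂) : prism G ≃g prism G where
  toEquiv := h.quadSwap_invol.toPerm
  map_rel_iff' := by
    intro x y
    refine ⟨fun k => ?_, fun k => h.quadSwap_adj k⟩
    have := h.quadSwap_adj k
    simpa [h.quadSwap_invol x, h.quadSwap_invol y] using this

theorem Quad.iso_image (h : Quad G p₁ p₂ s₁ s₂) :
    h.iso '' Set.range Sum.inl = quadSide p₁ p₂ s₁ s₂ := by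
  have d1 := h.adj₁.ne
  have d2 := h.adj₂.ne
  have d3 := h.hp
  have d4 := h.hs
  have d5 := h.hps₁
  have d6 := h.hps₂
  have e : ∀ x, h.iso x = quadSwap p₁ p₂ s₁ s₂ x := fun _ => rfl
  ext x
  obtain ⟨x, rfl⟩ := h.iso.surjective x
  rw [h.iso.injective.mem_set_image, e]
  rcases x with x | x <;> simp only [quadSide, quadSwap, Set.mem_range, Sum.inl.injEq, exists_eq,
    reduceCtorEq, exists_false, Set.mem_ofPred_eq] <;> grind

end Involution

end ComplPrism

namespace ComplPrism

universe u

variable {V : Type u}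

instance finite_iso [Finite V] (G : SimpleGraph V) : Finite (G ≃g G) :=
  Finite.of_injective _ RelIso.toEquiv_injective

/-! ### The orbit of the left summand and its size -/

section Sides

variable {G : SimpleGraph V}

/-- The images of the left summand under the automorphisms of the prism. -/
def sides (G : SimpleGraph V) : Set (Set (V ⊕ V)) :=
  {X | ∃ σ : prism G ≃g prism G, σ '' Set.range Sum.inl = X}

/-- An isomorphism of graphs induces one between the prisms. -/
def prismIso {W : Type*} {H : SimpleGraph W} (φ : G ≃g H) : prism G ≃g prism H where
  toEquiv := Equiv.sumCongr φ.toEquiv φ.toEquiv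
  map_rel_iff' := by
    have h : ∀ x y, H.Adj (φ x) (φ y) ↔ G.Adj x y := fun x y => φ.map_adj_iff
    rintro (x | x) (y | y) <;> simp [h]

/-- An isomorphism of a graph with its complement induces an automorphism of the prism
exchanging the two summands. -/
def prismSwap (φ : G ≃g Gᶜ) : prism G ≃g prism G where
  toEquiv := (Equiv.sumCongr φ.toEquiv φ.toEquiv).trans (Equiv.sumComm V V)
  map_rel_iff' := by
    have h : ∀ x y, (x ≠ y ∧ ¬ G.Adj (φ x) (φ y)) ↔ G.Adj x y := fun x y => by
      have := φ.map_adj_iff (v := x) (w := y)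
      rwa [SimpleGraph.compl_adj, φ.injective.ne_iff] at this
    have h' : ∀ x y, G.Adj (φ x) (φ y) ↔ x ≠ y ∧ ¬ G.Adj x y := fun x y => by
      rw [← h x y]
      by_cases e : x = y <;> simp [e]
    rintro (x | x) (y | y)
    · simpa using h x y
    · simp
    · simp
    · simpa using h' x y

theorem exists_iso_of_image_eq (σ : prism G ≃g prism G)
    (h : σ '' Set.range Sum.inl = Set.range Sum.inl) : ∃ φ : G ≃g G, prismIso φ = σ := by
  have adj : ∀ x y, (prism G).Adj (σ x) (σ y) ↔ (prism G).Adj x y := fun x y => σ.map_adj_iff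
  have h1 : ∀ x, σ x ∈ Set.range Sum.inl ↔ x ∈ Set.range Sum.inl := fun x => by
    conv_lhs => rw [← h]
    exact σ.injective.mem_set_image
  choose f hf using fun v => (h1 (.inl v)).2 ⟨v, rfl⟩
  have hr : ∀ v, σ (.inr v) = .inr (f v) := by
    intro v
    have a := (adj (.inl v) (.inr v)).2 (by simp)
    have b := h1 (.inr v)
    rw [← hf] at a
    rcases e : σ (.inr v) with w | w <;> rw [e] at a b
    · simp at b
    · simpa [eq_comm] using a
  have inj : Function.Injective f := by
    intro v w hvw
    have := (hf v).symm.trans ((congrArg Sum.inl hvw).trans (hf w))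
    simpa using σ.injective this
  have surj : Function.Surjective f := by
    intro v
    obtain ⟨x, hx⟩ := σ.surjective (.inl v)
    obtain ⟨w, rfl⟩ := (h1 x).1 ⟨v, hx.symm⟩
    exact ⟨w, by simpa [hx] using hf w⟩
  refine ⟨⟨Equiv.ofBijective f ⟨inj, surj⟩, ?_⟩, ?_⟩
  · intro v w
    change G.Adj (f v) (f w) ↔ G.Adj v w
    have := adj (.inl v) (.inl w)
    rwa [← hf, ← hf] at this
  · ext (v | v)
    · exact hf v
    · exact (hr v).symm

theorem isSelfCompl_of_image_eq (σ : prism G ≃g prism G)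
    (h : σ '' Set.range Sum.inl = (Set.range Sum.inl)ᶜ) : IsSelfCompl G := by
  have adj : ∀ x y, (prism G).Adj (σ x) (σ y) ↔ (prism G).Adj x y := fun x y => σ.map_adj_iff
  have h1 : ∀ x, σ x ∈ Set.range Sum.inr ↔ x ∈ Set.range Sum.inl := fun x => by
    rw [← Set.compl_range_inl, ← h]
    exact σ.injective.mem_set_image
  choose f hf using fun v => (h1 (.inl v)).2 ⟨v, rfl⟩
  have inj : Function.Injective f := by
    intro v w hvw
    have := (hf v).symm.trans ((congrArg Sum.inr hvw).trans (hf w))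
    simpa using σ.injective this
  have surj : Function.Surjective f := by
    intro v
    obtain ⟨x, hx⟩ := σ.surjective (.inr v)
    obtain ⟨w, rfl⟩ := (h1 x).1 ⟨v, hx.symm⟩
    exact ⟨w, by simpa [hx] using hf w⟩
  refine ⟨⟨Equiv.ofBijective f ⟨inj, surj⟩, ?_⟩⟩
  intro v w
  change Gᶜ.Adj (f v) (f w) ↔ G.Adj v w
  have := adj (.inl v) (.inl w)
  rwa [← hf, ← hf] at this

open scoped Pointwise in
theorem card_prism_aut [Finite V] (G : SimpleGraph V) :
    Nat.card (prism G ≃g prism G) = (sides G).ncard * Nat.card (G ≃g G) := by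
  have h := Subgroup.card_mul_index
    (MulAction.stabilizer (prism G ≃g prism G) (Set.range Sum.inl : Set (V ⊕ V)))
  rw [MulAction.index_stabilizer] at h
  rw [← h, mul_comm]
  congr 1
  have mem : ∀ φ : G ≃g G, prismIso φ ∈
      MulAction.stabilizer (prism G ≃g prism G) (Set.range Sum.inl : Set (V ⊕ V)) := by
    intro φ
    rw [MulAction.mem_stabilizer_iff]
    change prismIso φ '' Set.range Sum.inl = _
    ext (v | v)
    · simpa [prismIso] using φ.surjective v
    · simp [prismIso]
  refine Nat.card_congr (Equiv.ofBijective (fun φ => ⟨prismIso φ, mem φ⟩) ⟨?_, ?_⟩).symm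
  · intro φ ψ h
    ext v
    have := RelIso.ext_iff.1 (Subtype.ext_iff.1 h) (.inl v)
    simpa [prismIso] using this
  · rintro ⟨σ, hσ⟩
    obtain ⟨φ, rfl⟩ := exists_iso_of_image_eq σ hσ
    exact ⟨φ, rfl⟩

theorem autRatio_eq [Finite V] (G : SimpleGraph V) : autRatio G = (sides G).ncard := by
  have : Nat.card (G ≃g G) ≠ 0 := Nat.card_pos.ne'
  rw [autRatio, card_prism_aut]
  push_cast
  field_simp

theorem range_mem_sides (G : SimpleGraph V) : Set.range Sum.inl ∈ sides G :=
  ⟨RelIso.refl _, by ext; simp⟩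

theorem Quad.mem_sides {p₁ p₂ s₁ s₂ : V} (h : Quad G p₁ p₂ s₁ s₂) :
    quadSide p₁ p₂ s₁ s₂ ∈ sides G :=
  ⟨h.iso, h.iso_image⟩

/-- If `σ` and `τ` produce complementary sides, then `σ⁻¹ τ` exchanges the two summands; conversely,
such an exchange can be applied before `σ`. -/
theorem compl_mem_sides {X : Set (V ⊕ V)} (hX : X ∈ sides G) :
    Xᶜ ∈ sides G ↔ IsSelfCompl G := by
  obtain ⟨σ, rfl⟩ := hX
  constructor
  · rintro ⟨τ, hτ⟩
    apply isSelfCompl_of_image_eq (τ.trans σ.symm)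
    have : (τ.trans σ.symm : V ⊕ V → V ⊕ V) = σ.symm ∘ τ := rfl
    rw [this, Set.image_comp, hτ, Set.image_compl_eq σ.symm.bijective, Set.image_image]
    simp
  · rintro ⟨φ⟩
    refine ⟨(prismSwap φ).trans σ, ?_⟩
    have : ((prismSwap φ).trans σ : V ⊕ V → V ⊕ V) = σ ∘ prismSwap φ := rfl
    rw [this, Set.image_comp, ← Set.image_compl_eq σ.bijective]
    congr 1
    ext (v | v)
    · simp [prismSwap]
    · simpa [prismSwap] using φ.surjective v

theorem sides_cases {X : Set (V ⊕ V)} (hX : X ∈ sides G) :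
    (X = Set.range Sum.inl ∨ ∃ p₁ p₂ s₁ s₂, Quad G p₁ p₂ s₁ s₂ ∧ X = quadSide p₁ p₂ s₁ s₂) ∨
    (Xᶜ = Set.range Sum.inl ∨ ∃ p₁ p₂ s₁ s₂, Quad G p₁ p₂ s₁ s₂ ∧ Xᶜ = quadSide p₁ p₂ s₁ s₂) := by
  obtain ⟨σ, rfl⟩ := hX
  exact (isSplit_image σ).cases

theorem ne_compl_set {α : Type*} [Nonempty α] (X : Set α) : X ≠ Xᶜ := by
  inhabit α
  intro h
  have := Set.ext_iff.1 h default
  simp at this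

theorem Quad.quadSide_ne {p₁ p₂ s₁ s₂ : V} (h : Quad G p₁ p₂ s₁ s₂) :
    quadSide p₁ p₂ s₁ s₂ ≠ Set.range Sum.inl ∧ quadSide p₁ p₂ s₁ s₂ ≠ (Set.range Sum.inl)ᶜ := by
  refine ⟨fun e => ?_, fun e => ?_⟩
  · have := Set.ext_iff.1 e (.inr p₁)
    simp [quadSide] at this
  · have := Set.ext_iff.1 e (.inl p₁)
    simp [quadSide, h.adj₁.ne, h.hps₁] at this

variable [Nonempty V]

theorem ncard_sides_of_no_quad (hq : ∀ p₁ p₂ s₁ s₂, ¬ Quad G p₁ p₂ s₁ s₂) :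
    (IsSelfCompl G → (sides G).ncard = 2) ∧ (¬ IsSelfCompl G → (sides G).ncard = 1) := by
  have h0 := range_mem_sides G
  have hc : ∀ X ∈ sides G, X = Set.range Sum.inl ∨ X = (Set.range Sum.inl)ᶜ := by
    intro X hX
    rcases sides_cases hX with (h | ⟨_, _, _, _, h, -⟩) | (h | ⟨_, _, _, _, h, -⟩)
    · exact Or.inl h
    · exact (hq _ _ _ _ h).elim
    · exact Or.inr (by rw [← h, compl_compl])
    · exact (hq _ _ _ _ h).elim
  have h1 := compl_mem_sides h0
  constructor
  · intro hs
    have : sides G = {Set.range Sum.inl, (Set.range Sum.inl)ᶜ} := by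
      ext X
      have := hc X
      grind
    rw [this, Set.ncard_pair (ne_compl_set _)]
  · intro hs
    have : sides G = {Set.range Sum.inl} := by
      ext X
      have := hc X
      grind
    rw [this, Set.ncard_singleton]

theorem Quad.ncard_sides {p₁ p₂ s₁ s₂ : V} (h : Quad G p₁ p₂ s₁ s₂)
    (hu : ∀ p₁' p₂' s₁' s₂', Quad G p₁' p₂' s₁' s₂' →
      quadSide p₁' p₂' s₁' s₂' = quadSide p₁ p₂ s₁ s₂ ∨
      quadSide p₁' p₂' s₁' s₂' = (quadSide p₁ p₂ s₁ s₂)ᶜ) :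
    (IsSelfCompl G → (sides G).ncard = 4) ∧ (¬ IsSelfCompl G → (sides G).ncard = 2) := by
  have h0 := range_mem_sides G
  have hm := h.mem_sides
  have hne := h.quadSide_ne
  set Y := quadSide p₁ p₂ s₁ s₂
  set X₀ : Set (V ⊕ V) := Set.range Sum.inl
  have hc : ∀ X ∈ sides G, X = X₀ ∨ X = X₀ᶜ ∨ X = Y ∨ X = Yᶜ := by
    intro X hX
    rcases sides_cases hX with (h | ⟨_, _, _, _, h, h'⟩) | (h | ⟨_, _, _, _, h, h'⟩)
    · exact Or.inl h
    · have := hu _ _ _ _ h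
      grind
    · exact Or.inr (Or.inl (compl_injective (by rw [h, compl_compl])))
    · have := hu _ _ _ _ h
      rw [← h', compl_eq_comm, eq_comm, compl_inj_iff] at this
      grind
  have h1 := compl_mem_sides h0
  have h2 := compl_mem_sides hm
  constructor
  · intro hs
    have : sides G = {X₀, X₀ᶜ, Y, Yᶜ} := by
      ext X
      have := hc X
      grind
    have n1 := ne_compl_set X₀
    have n2 := ne_compl_set Y
    have n3 : Yᶜ ≠ X₀ := fun e => hne.2 (by rw [← e, compl_compl])
    have n4 : Yᶜ ≠ X₀ᶜ := fun e => hne.1 (compl_injective e)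
    rw [this, Set.ncard_insert_of_notMem (by grind), Set.ncard_insert_of_notMem (by grind),
      Set.ncard_pair n2]
  · intro hs
    have : sides G = {X₀, Y} := by
      ext X
      have := hc X
      grind
    rw [this, Set.ncard_pair hne.1.symm]

end Sides

end ComplPrism

namespace ComplPrism

universe u

/-! ### Invariance under isomorphism -/

section Iso

variable {V W : Type*} {G : SimpleGraph V} {H : SimpleGraph W}

/-- An isomorphism of graphs is an isomorphism of their complements. -/
def isoCompl (e : G ≃g H) : Gᶜ ≃g Hᶜ where
  toEquiv := e.toEquiv
  map_rel_iff' := by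
    intro v w
    change Hᶜ.Adj (e v) (e w) ↔ _
    rw [SimpleGraph.compl_adj, SimpleGraph.compl_adj, e.map_adj_iff, e.injective.ne_iff]

end Iso

theorem isSelfCompl_congr {V W : Type*} {G : SimpleGraph V} {H : SimpleGraph W} (e : G ≃g H) :
    IsSelfCompl G ↔ IsSelfCompl H :=
  ⟨fun ⟨φ⟩ => ⟨(e.symm.trans φ).trans (isoCompl e)⟩,
    fun ⟨φ⟩ => ⟨(e.trans φ).trans (isoCompl e.symm)⟩⟩

theorem isSelfCompl_of_subsingleton {V : Type*} [Subsingleton V] (G : SimpleGraph V) :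
    IsSelfCompl G :=
  ⟨⟨Equiv.refl V, fun {a b} => by
    obtain rfl := Subsingleton.elim a b
    simp⟩⟩

/-- Conjugation by an isomorphism of graphs. -/
def autCongr {V W : Type*} {G : SimpleGraph V} {H : SimpleGraph W} (e : G ≃g H) :
    (G ≃g G) ≃ (H ≃g H) where
  toFun f := (e.symm.trans f).trans e
  invFun f := (e.trans f).trans e.symm
  left_inv f := by ext; simp
  right_inv f := by ext; simp

theorem autRatio_congr {V W : Type*} {G : SimpleGraph V} {H : SimpleGraph W} (e : G ≃g H) :
    autRatio G = autRatio H := by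
  rw [autRatio, autRatio, Nat.card_congr (autCongr e), Nat.card_congr (autCongr (prismIso e))]

/-! ### Quads and vertex substitution -/

section Subst

variable {W : Type u} (B : SimpleGraph (Fin 5)) (L : SimpleGraph W)

@[simp] theorem substVertex_inl_inl (x y : {x : Fin 5 // x ≠ 0}) :
    (substVertex B 0 L).Adj (.inl x) (.inl y) ↔ B.Adj x y := Iff.rfl
@[simp] theorem substVertex_inr_inr (x y : W) :
    (substVertex B 0 L).Adj (.inr x) (.inr y) ↔ L.Adj x y := Iff.rfl
@[simp] theorem substVertex_inl_inr (x : {x : Fin 5 // x ≠ 0}) (y : W) :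
    (substVertex B 0 L).Adj (.inl x) (.inr y) ↔ B.Adj x 0 := Iff.rfl
@[simp] theorem substVertex_inr_inl (x : W) (y : {x : Fin 5 // x ≠ 0}) :
    (substVertex B 0 L).Adj (.inr x) (.inl y) ↔ B.Adj y 0 := Iff.rfl

variable {B L} {a b c d : {x : Fin 5 // x ≠ 0}}

theorem eq_of_distinct (hab : a ≠ b) (hac : a ≠ c) (had : a ≠ d) (hbc : b ≠ c) (hbd : b ≠ d)
    (hcd : c ≠ d) (x : {x : Fin 5 // x ≠ 0}) : x = a ∨ x = b ∨ x = c ∨ x = d := by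
  obtain ⟨a, ha⟩ := a
  obtain ⟨b, hb⟩ := b
  obtain ⟨c, hc⟩ := c
  obtain ⟨d, hd⟩ := d
  obtain ⟨x, hx⟩ := x
  simp only [ne_eq, Subtype.mk.injEq] at *
  omega

theorem Quad.forall_eq (h : Quad B a b c d) (x : {x : Fin 5 // x ≠ 0}) :
    x = a ∨ x = b ∨ x = c ∨ x = d := by
  have h1 := h.adj₁.ne
  have h2 := h.adj₂.ne
  have h3 := h.hp
  have h4 := h.hs
  have h5 := h.hps₁
  have h6 := h.hps₂
  apply eq_of_distinct <;> grind

theorem Quad.substVertex (h : Quad B a b c d) :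
    Quad (substVertex B 0 L) (.inl a) (.inl b) (.inl c) (.inl d) := by
  have hx := h.forall_eq
  obtain ⟨h1, h2, h3, h4, h5, h6, h7, h8, h9, h10⟩ := h
  have h0 := h10 0 a.2.symm b.2.symm c.2.symm d.2.symm
  simp only [B.adj_comm 0] at h0
  constructor
  case rest =>
    rintro (q | q) q1 q2 q3 q4
    · have := hx q
      grind
    · simpa using h0
  all_goals simp_all [Subtype.ext_iff]

/-- A quad fixes every adjacency except `p₁ p₂`, which in turn decides `s₁ s₂`, and those among the
remaining vertices. In `B` the only remaining vertex is `0`. -/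
theorem Quad.nonempty_iso {V : Type u} {G : SimpleGraph V} {p₁ p₂ s₁ s₂ : V}
    (h : Quad G p₁ p₂ s₁ s₂) (hB : Quad B a b c d) (hadj : G.Adj p₁ p₂ ↔ B.Adj a b) :
    Nonempty (G ≃g ComplPrism.substVertex B 0
      (G.comap (Subtype.val : {v // v ≠ p₁ ∧ v ≠ p₂ ∧ v ≠ s₁ ∧ v ≠ s₂} → V))) := by
  have hx := hB.forall_eq
  have d1 := h.adj₁.ne
  have d2 := h.adj₂.ne
  have e1 := hB.adj₁.ne
  have e2 := hB.adj₂.ne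
  obtain ⟨h1, h2, h3, h4, h5, h6, h7, h8, h9, h10⟩ := h
  obtain ⟨b1, b2, b3, b4, b5, b6, b7, b8, b9, b10⟩ := hB
  have b0 := b10 0 a.2.symm b.2.symm c.2.symm d.2.symm
  let g : {x : Fin 5 // x ≠ 0} ⊕ {v // v ≠ p₁ ∧ v ≠ p₂ ∧ v ≠ s₁ ∧ v ≠ s₂} → V :=
    Sum.elim (fun x => if x = a then p₁ else if x = b then p₂ else if x = c then s₁ else s₂)
      Subtype.val
  have ga : g (.inl a) = p₁ := by simp [g]
  have gb : g (.inl b) = p₂ := by simp only [g, Sum.elim_inl]; grind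
  have gc : g (.inl c) = s₁ := by simp only [g, Sum.elim_inl]; grind
  have gd : g (.inl d) = s₂ := by simp only [g, Sum.elim_inl]; grind
  have gw : ∀ w, g (.inr w) = w := fun _ => rfl
  clear_value g
  have inj : Function.Injective g := by
    rintro (x | x) (y | y) hxy
    · rcases hx x with rfl | rfl | rfl | rfl <;> rcases hx y with rfl | rfl | rfl | rfl <;> grind
    · have := y.2
      rcases hx x with rfl | rfl | rfl | rfl <;> grind
    · have := x.2
      rcases hx y with rfl | rfl | rfl | rfl <;> grind
    · rw [gw, gw] at hxy
      rw [Subtype.ext hxy]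
  have surj : Function.Surjective g := by
    intro v
    by_cases hv : v ≠ p₁ ∧ v ≠ p₂ ∧ v ≠ s₁ ∧ v ≠ s₂
    · exact ⟨.inr ⟨v, hv⟩, gw _⟩
    · grind
  refine ⟨RelIso.symm ⟨Equiv.ofBijective g ⟨inj, surj⟩, @fun x y => ?_⟩⟩
  change G.Adj (g x) (g y) ↔ _
  rcases x with x | x <;> rcases y with y | y
  · rw [substVertex_inl_inl]
    rcases hx x with rfl | rfl | rfl | rfl <;> rcases hx y with rfl | rfl | rfl | rfl <;>
      grind [SimpleGraph.adj_comm, SimpleGraph.irrefl]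
  · rw [substVertex_inl_inr, gw]
    obtain ⟨y1, y2, y3, y4⟩ := y.2
    have := h10 y y1 y2 y3 y4
    rcases hx x with rfl | rfl | rfl | rfl <;> grind [SimpleGraph.adj_comm]
  · rw [substVertex_inr_inl, gw]
    obtain ⟨y1, y2, y3, y4⟩ := x.2
    have := h10 x y1 y2 y3 y4
    rcases hx y with rfl | rfl | rfl | rfl <;> grind [SimpleGraph.adj_comm]
  · rw [substVertex_inr_inr, gw, gw]
    rfl

theorem IsSelfCompl.substVertex (π : Equiv.Perm (Fin 5)) (h0 : π 0 = 0)
    (hπ : ∀ x y, x ≠ y → (B.Adj (π x) (π y) ↔ ¬ B.Adj x y)) (hL : IsSelfCompl L) :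
    IsSelfCompl (substVertex B 0 L) := by
  obtain ⟨φ⟩ := hL
  have hne : ∀ x, x ≠ 0 ↔ π x ≠ 0 := fun x => by
    conv_rhs => rw [← h0, π.injective.ne_iff]
  have hφ : ∀ x y, (x ≠ y ∧ ¬ L.Adj (φ x) (φ y)) ↔ L.Adj x y := fun x y => by
    have := φ.map_adj_iff (v := x) (w := y)
    rwa [SimpleGraph.compl_adj, φ.injective.ne_iff] at this
  have hπ' : ∀ x y, (x ≠ y ∧ ¬ B.Adj (π x) (π y)) ↔ B.Adj x y := fun x y => by
    by_cases e : x = y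
    · simp [e]
    · simp [hπ x y e, e]
  have hπ0 : ∀ x, x ≠ 0 → (¬ B.Adj (π x) 0 ↔ B.Adj x 0) := fun x hx => by
    rw [← hπ' x 0, h0]
    simp [hx]
  refine ⟨⟨Equiv.sumCongr (π.subtypeEquiv hne) φ.toEquiv, ?_⟩⟩
  rintro (x | x) (y | y)
  · simpa [SimpleGraph.compl_adj, Subtype.ext_iff] using hπ' x y
  · simpa [SimpleGraph.compl_adj] using hπ0 x x.2
  · simpa [SimpleGraph.compl_adj] using hπ0 y y.2
  · simpa [SimpleGraph.compl_adj] using hφ x y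

theorem card_substVertex [Finite W] :
    Nat.card ({x : Fin 5 // x ≠ 0} ⊕ W) = 4 + Nat.card W := by
  rw [Nat.card_sum, Nat.card_eq_fintype_card]
  rfl

/-- By uniqueness of the quad, an isomorphism onto the complement preserves its four vertices, hence
restricts to `L`. Uniqueness needs six vertices; a smaller `L` has at most one vertex. -/
theorem Quad.isSelfCompl_of_substVertex [Finite W] (hB : Quad B a b c d)
    (hG : IsSelfCompl (ComplPrism.substVertex B 0 L)) : IsSelfCompl L := by
  rcases Nat.lt_or_ge (Nat.card W) 2 with h2 | h2
  · have : Subsingleton W := Finite.card_le_one_iff_subsingleton.1 (by omega)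
    exact isSelfCompl_of_subsingleton L
  obtain ⟨τ⟩ := hG
  have hx := hB.forall_eq
  have hq := hB.substVertex (L := L)
  have h6 : 6 ≤ Nat.card ({x : Fin 5 // x ≠ 0} ⊕ W) := by
    rw [card_substVertex]
    omega
  -- Both the complemented quad and the image of the quad under `τ` are quads of the complement.
  have hs := hq.compl.s_eq (Or.inl h6) (hq.map τ)
  have hp := hq.compl.p_eq (Or.inl h6) (hq.map τ)
  have hτ : ∀ w, ∃ w', τ (.inr w) = .inr w' := by
    intro w
    rcases e : τ (.inr w) with x | w'
    · exfalso
      have key : ∃ y, τ (.inl y) = .inl x := by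
        rcases hx x with rfl | rfl | rfl | rfl <;> grind
      obtain ⟨y, hy⟩ := key
      have := τ.injective (hy.trans e.symm)
      simp at this
    · exact ⟨w', rfl⟩
  choose f hf using hτ
  have inj : Function.Injective f := by
    intro v w hvw
    have := (hf v).trans ((congrArg Sum.inr hvw).trans (hf w).symm)
    simpa using τ.injective this
  refine ⟨⟨Equiv.ofBijective f (Finite.injective_iff_bijective.1 inj), @fun v w => ?_⟩⟩
  change Lᶜ.Adj (f v) (f w) ↔ L.Adj v w
  have := τ.map_adj_iff (v := .inr v) (w := .inr w)
  rw [hf, hf] at this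
  simpa [SimpleGraph.compl_adj] using this

end Subst

/-! ### The `A`-graph and the pentagon -/

section Base

theorem aGraph_adj (x y : Fin 5) : aGraph.Adj x y ↔
    (s(x, y) = s(0, 1) ∨ s(x, y) = s(0, 2) ∨ s(x, y) = s(1, 2) ∨ s(x, y) = s(1, 3) ∨
      s(x, y) = s(2, 4)) ∧ x ≠ y := by
  simp [aGraph, SimpleGraph.fromEdgeSet_adj]

instance : DecidableRel aGraph.Adj := fun x y => decidable_of_iff _ (aGraph_adj x y).symm

instance : DecidableRel pentagon.Adj :=
  inferInstanceAs (DecidableRel (SimpleGraph.cycleGraph 5).Adj)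

theorem quad_aGraph : Quad aGraph 1 2 3 4 := by
  constructor <;> decide

theorem quad_pentagon (i : Fin 5) : Quad pentagon (i + 1) (i + 4) (i + 2) (i + 3) := by
  constructor <;> revert i <;> decide

set_option synthInstance.maxSize 1000 in
set_option synthInstance.maxHeartbeats 200000 in
theorem eq_of_quad_pentagon {p₁ p₂ s₁ s₂ : Fin 5} (h : Quad pentagon p₁ p₂ s₁ s₂) :
    ∃ i : Fin 5, (p₁ = i + 1 ∧ p₂ = i + 4 ∨ p₁ = i + 4 ∧ p₂ = i + 1) ∧
      (s₁ = i + 2 ∧ s₂ = i + 3 ∨ s₁ = i + 3 ∧ s₂ = i + 2) := by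
  obtain ⟨h1, h2, h3, h4, h5, h6, h7, h8, h9, h10⟩ := h
  revert p₁ p₂ s₁ s₂
  decide

theorem isSelfCompl_aOf {W : Type u} {L : SimpleGraph W} (hL : IsSelfCompl L) :
    IsSelfCompl (aOf L) :=
  -- The permutation `p₁ → s₁ → p₂ → s₂ → p₁` suggested by `Quad.compl`.
  hL.substVertex ⟨![0, 3, 4, 2, 1], ![0, 4, 3, 1, 2], by decide, by decide⟩ (by decide)
    (by decide)

theorem isSelfCompl_c5 {W : Type u} {L : SimpleGraph W} (hL : IsSelfCompl L) :
    IsSelfCompl (c5 L) :=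
  -- Doubling modulo 5 turns differences ±1 into ±2, so it carries the pentagon to its complement.
  hL.substVertex ⟨fun x => 2 * x, fun x => 3 * x, by decide, by decide⟩ (by decide) (by decide)

theorem isPentagon_c5 {W : Type u} (L : SimpleGraph W) (hW : Nat.card W = 1) :
    IsPentagon (c5 L) := by
  obtain ⟨hs, ⟨w⟩⟩ := Nat.card_eq_one_iff_unique.1 hW
  refine ⟨⟨Equiv.ofBijective (Sum.elim Subtype.val fun _ => 0) ⟨?_, ?_⟩, ?_⟩⟩
  · rintro (x | x) (y | y) h
    · exact congrArg _ (Subtype.ext h)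
    · exact (x.2 h).elim
    · exact (y.2 h.symm).elim
    · rw [Subsingleton.elim x y]
  · intro x
    by_cases hx : x = 0
    · exact ⟨.inr w, hx.symm⟩
    · exact ⟨.inl ⟨x, hx⟩, rfl⟩
  · rintro (x | x) (y | y)
    · rfl
    · rfl
    · exact pentagon.adj_comm _ _
    · obtain rfl := Subsingleton.elim x y
      simp

/-- Membership in the twelve images of the outer pentagon under automorphisms of the
Petersen graph. -/
def pentagonSide : Option (Fin 5) × Bool → Fin 5 ⊕ Fin 5 → Bool
  | (none, t), .inl _ => t
  | (none, t), .inr _ => !t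
  | (some i, t), .inl v => t == decide (v ≠ i + 2 ∧ v ≠ i + 3)
  | (some i, t), .inr v => t == decide (v = i + 1 ∨ v = i + 4)

theorem pentagonSide_injective : Function.Injective pentagonSide := by
  intro p q h
  have h' : ∀ x, pentagonSide p x = pentagonSide q x := congrFun h
  clear h
  revert p q
  decide

end Base

end ComplPrism

namespace ComplPrism

universe u

/-! ### Evaluation of the ratio -/

section Ratio

variable {V : Type u} [Finite V] [Nonempty V] {G : SimpleGraph V}

theorem autRatio_of_no_quad (hq : ∀ p₁ p₂ s₁ s₂, ¬ Quad G p₁ p₂ s₁ s₂) :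
    (IsSelfCompl G → autRatio G = 2) ∧ (¬ IsSelfCompl G → autRatio G = 1) := by
  rw [autRatio_eq]
  have h := ncard_sides_of_no_quad hq
  exact ⟨fun k => by simp [h.1 k], fun k => by simp [h.2 k]⟩

theorem Quad.autRatio {p₁ p₂ s₁ s₂ : V} (h : Quad G p₁ p₂ s₁ s₂)
    (hc : Nat.card V ≠ 5 ∨ G.Adj p₁ p₂) :
    (IsSelfCompl G → autRatio G = 4) ∧ (¬ IsSelfCompl G → autRatio G = 2) := by
  rw [autRatio_eq]
  have h := h.ncard_sides fun _ _ _ _ h' => h.side_eq hc h'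
  exact ⟨fun k => by simp [h.1 k], fun k => by simp [h.2 k]⟩

theorem quad_aGraph_sub :
    Quad aGraph (⟨1, by decide⟩ : {x : Fin 5 // x ≠ 0}) (⟨2, by decide⟩ : {x : Fin 5 // x ≠ 0})
      (⟨3, by decide⟩ : {x : Fin 5 // x ≠ 0}) (⟨4, by decide⟩ : {x : Fin 5 // x ≠ 0}) :=
  quad_aGraph

theorem quad_pentagon_sub :
    Quad pentagon (⟨1, by decide⟩ : {x : Fin 5 // x ≠ 0}) (⟨4, by decide⟩ : {x : Fin 5 // x ≠ 0})
      (⟨2, by decide⟩ : {x : Fin 5 // x ≠ 0}) (⟨3, by decide⟩ : {x : Fin 5 // x ≠ 0}) := by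
  simpa using quad_pentagon 0

theorem isSelfCompl_aOf_iff {W : Type u} [Finite W] {L : SimpleGraph W} :
    IsSelfCompl (aOf L) ↔ IsSelfCompl L :=
  ⟨quad_aGraph_sub.isSelfCompl_of_substVertex, isSelfCompl_aOf⟩

theorem isSelfCompl_c5_iff {W : Type u} [Finite W] {L : SimpleGraph W} :
    IsSelfCompl (c5 L) ↔ IsSelfCompl L :=
  ⟨quad_pentagon_sub.isSelfCompl_of_substVertex, isSelfCompl_c5⟩

theorem autRatio_aOf {W : Type u} [Finite W] {L : SimpleGraph W} (e : G ≃g aOf L) :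
    (IsSelfCompl L → autRatio G = 4) ∧ (¬ IsSelfCompl L → autRatio G = 2) := by
  rw [← isSelfCompl_aOf_iff, ← isSelfCompl_congr e]
  refine (quad_aGraph_sub.substVertex.map e.symm).autRatio (Or.inr ?_)
  rw [e.symm.map_adj_iff]
  change aGraph.Adj 1 2
  decide

theorem autRatio_c5 {W : Type u} [Finite W] {L : SimpleGraph W} (e : G ≃g c5 L)
    (hW : Nat.card W ≠ 1) :
    (IsSelfCompl L → autRatio G = 4) ∧ (¬ IsSelfCompl L → autRatio G = 2) := by
  rw [← isSelfCompl_c5_iff, ← isSelfCompl_congr e]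
  refine (quad_pentagon_sub.substVertex.map e.symm).autRatio (Or.inl ?_)
  rw [Nat.card_congr e.toEquiv, card_substVertex]
  omega

omit [Nonempty V] in
theorem exists_iso_of_quad {p₁ p₂ s₁ s₂ : V} (h : Quad G p₁ p₂ s₁ s₂) :
    ∃ (W : Type u) (_ : Finite W) (L : SimpleGraph W),
      Nonempty (G ≃g aOf L) ∨ Nonempty (G ≃g c5 L) := by
  refine ⟨{v // v ≠ p₁ ∧ v ≠ p₂ ∧ v ≠ s₁ ∧ v ≠ s₂}, inferInstance, G.comap Subtype.val, ?_⟩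
  -- The pair `p₁ p₂` is an edge in the `A`-graph and a non-edge in the pentagon.
  by_cases ha : G.Adj p₁ p₂
  · refine Or.inl (h.nonempty_iso quad_aGraph_sub (iff_of_true ha ?_))
    decide
  · refine Or.inr (h.nonempty_iso quad_pentagon_sub (iff_of_false ha ?_))
    decide

omit [Nonempty V] in
/-- A graph admitting a `Quad` is one of the graphs with additional automorphisms of the prism. -/
theorem Quad.classify {p₁ p₂ s₁ s₂ : V} (h : Quad G p₁ p₂ s₁ s₂) :
    IsPentagon G ∨ IsExtensionOfSelfCompl G ∨ (IsExtensionOfNonSelfCompl G ∧ ¬ IsSelfCompl G) := by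
  obtain ⟨W, hW, L, hL⟩ := exists_iso_of_quad h
  by_cases hs : IsSelfCompl L
  · by_cases h1 : Nat.card W = 1
    · rcases hL with hL | ⟨⟨e⟩⟩
      · exact Or.inr (Or.inl ⟨W, hW, L, hs, Or.inl hL⟩)
      · obtain ⟨e'⟩ := isPentagon_c5 L h1
        exact Or.inl ⟨e.trans e'⟩
    · exact Or.inr (Or.inl ⟨W, hW, L, hs, hL.imp_right fun k => ⟨k, h1⟩⟩)
  · refine Or.inr (Or.inr ⟨⟨W, hW, L, hs, hL⟩, ?_⟩)
    rcases hL with ⟨⟨e⟩⟩ | ⟨⟨e⟩⟩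
    · rwa [isSelfCompl_congr e, isSelfCompl_aOf_iff]
    · rwa [isSelfCompl_congr e, isSelfCompl_c5_iff]

theorem IsExtensionOfSelfCompl.autRatio (h : IsExtensionOfSelfCompl G) : autRatio G = 4 := by
  obtain ⟨W, _, L, hL, ⟨⟨e⟩⟩ | ⟨⟨e⟩, h1⟩⟩ := h
  · exact (autRatio_aOf e).1 hL
  · exact (autRatio_c5 e h1).1 hL

theorem IsExtensionOfNonSelfCompl.autRatio (h : IsExtensionOfNonSelfCompl G) :
    autRatio G = 2 := by
  obtain ⟨W, _, L, hL, ⟨⟨e⟩⟩ | ⟨⟨e⟩⟩⟩ := h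
  · exact (autRatio_aOf e).2 hL
  -- A one-vertex `L` would be self-complementary, so the pentagon does not occur here.
  · refine (autRatio_c5 e fun h1 => hL ?_).2 hL
    have : Subsingleton W := (Nat.card_eq_one_iff_unique.1 h1).1
    exact isSelfCompl_of_subsingleton L

theorem isSelfCompl_pentagon : IsSelfCompl pentagon := by
  obtain ⟨e⟩ := isPentagon_c5 (⊥ : SimpleGraph PUnit.{1}) (by simp)
  rw [← isSelfCompl_congr e, isSelfCompl_c5_iff]
  exact isSelfCompl_of_subsingleton _

/-- There is one quad side for each vertex `i`, the vertex outside the quad. With the left summand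
these make six sides, and self-complementarity adds their complements. -/
theorem sides_pentagon :
    sides pentagon = Set.range fun p => {x | pentagonSide p x = true} := by
  have none_eq : {x | pentagonSide (none, true) x = true} = Set.range Sum.inl := by
    ext (x | x) <;> simp [pentagonSide]
  have some_eq : ∀ i : Fin 5, {x | pentagonSide (some i, true) x = true} =
      quadSide (i + 1) (i + 4) (i + 2) (i + 3) := by
    intro i
    ext (x | x) <;> simp [pentagonSide, quadSide]
  have compl_eq : ∀ o, {x | pentagonSide (o, false) x = true} =
      {x | pentagonSide (o, true) x = true}ᶜ := by
    rintro (_ | i) <;> ext (x | x) <;> simp [pentagonSide, or_iff_not_imp_left]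
  have main : ∀ X : Set (Fin 5 ⊕ Fin 5), (X = Set.range Sum.inl ∨
      ∃ p₁ p₂ s₁ s₂, Quad pentagon p₁ p₂ s₁ s₂ ∧ X = quadSide p₁ p₂ s₁ s₂) →
      ∃ o, {x | pentagonSide (o, true) x = true} = X := by
    rintro X (rfl | ⟨p₁, p₂, s₁, s₂, h, rfl⟩)
    · exact ⟨none, none_eq⟩
    · obtain ⟨i, hp, hs⟩ := eq_of_quad_pentagon h
      refine ⟨some i, (some_eq i).trans ?_⟩
      ext (x | x) <;> simp only [quadSide, Set.mem_ofPred_eq, Sum.elim_inl, Sum.elim_inr] <;> grind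
  ext X
  constructor
  · intro hX
    rcases sides_cases hX with h | h
    · obtain ⟨o, ho⟩ := main _ h
      exact ⟨(o, true), ho⟩
    · obtain ⟨o, ho⟩ := main _ h
      exact ⟨(o, false), (compl_eq o).trans (by rw [ho, compl_compl])⟩
  · have mem : ∀ o, {x | pentagonSide (o, true) x = true} ∈ sides pentagon := by
      rintro (_ | i)
      · rw [none_eq]
        exact range_mem_sides _
      · rw [some_eq]
        exact (quad_pentagon i).mem_sides
    rintro ⟨⟨o, _ | _⟩, rfl⟩
    · simp only [compl_eq]
      exact (compl_mem_sides (mem o)).2 isSelfCompl_pentagon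
    · exact mem o

omit [Finite V] [Nonempty V] in
theorem IsPentagon.autRatio (h : IsPentagon G) : autRatio G = 12 := by
  obtain ⟨e⟩ := h
  rw [autRatio_congr e, autRatio_eq, sides_pentagon, ← Set.image_univ, Set.ncard_image_of_injective,
    Set.ncard_univ, Nat.card_eq_fintype_card]
  · simp
  · intro p q h
    apply pentagonSide_injective
    funext x
    have := Set.ext_iff.1 h x
    simpa using this

end Ratio

end ComplPrism

theorem mainTheorem4 {V : Type*} [Finite V] [Nonempty V] (G : SimpleGraph V) :
    (ComplPrism.IsPentagon G → ComplPrism.autRatio G = 12) ∧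
    (ComplPrism.IsExtensionOfSelfCompl G → ComplPrism.autRatio G = 4) ∧
    ((ComplPrism.IsSelfCompl G ∧ ¬ ComplPrism.IsPentagon G ∧
          ¬ ComplPrism.IsExtensionOfSelfCompl G) ∨
        ComplPrism.IsExtensionOfNonSelfCompl G →
      ComplPrism.autRatio G = 2) ∧
    (¬ ComplPrism.IsPentagon G ∧ ¬ ComplPrism.IsExtensionOfSelfCompl G ∧
        ¬ ComplPrism.IsSelfCompl G ∧ ¬ ComplPrism.IsExtensionOfNonSelfCompl G →
      ComplPrism.autRatio G = 1) := by
  refine ⟨fun h => h.autRatio, fun h => h.autRatio, ?_, ?_⟩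
  · rintro (⟨hs, hp, he⟩ | h)
    -- A quad would make `G` the pentagon, an extension of a self-complementary graph, or not
    -- self-complementary; all three are excluded.
    · refine (ComplPrism.autRatio_of_no_quad fun _ _ _ _ hq => ?_).1 hs
      rcases hq.classify with h | h | h
      exacts [hp h, he h, h.2 hs]
    · exact h.autRatio
  · rintro ⟨hp, he, hs, hn⟩
    refine (ComplPrism.autRatio_of_no_quad fun _ _ _ _ hq => ?_).2 hs
    rcases hq.classify with h | h | h
    exacts [hp h, he h, hn h.1]
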